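/- Let $\mathbb{F}_q$ be a finite field with $q$ elements, $T$ an indeterminate, and $\overline{\mathbb{F}_q(T)}$ an algebraic closure of $\mathbb{F}_q(T)$. For $M=\sum_i a_iT^i\in\mathbb{F}_q[T]$ and $u\in\overline{\mathbb{F}_q(T)}$ let $u_q^M:=\sum_i a_i(\phi_q+\mu_T)^i(u)$ be the Carlitz action, where $\phi_q(u)=u^q$ and $\mu_T(u)=Tu$. Let $$\mathbb{T}_q=\bigcup_{0\neq M\in\mathbb{F}_q[T]}\{u\in\overline{\mathbb{F}_q(T)} : u_q^M=0\}$$ be the set of Carlitz torsion points. Let $\mathfrak{P}$ be any place of $\overline{\mathbb{F}_q(T)}$ above the infinite place of $\mathbb{F}_q(T)$ (the pole of $T$), let $\mathbb{C}_{\mathfrak{P}}$ be the completion of $\overline{\mathbb{F}_q(T)}$ at $\mathfrak{P}$, and let $\mathbb{S}_q\subset\mathbb{C}_{\mathfrak{P}}$ be the completion of $\mathbb{T}_q$ at $\mathfrak{P}$, i.e. the closure of $\mathbb{T}_q$ in $\mathbb{C}_{\mathfrak{P}}$. Suppose that $\lambda\in\mathbb{S}_q$ is integral over $\mathbb{F}_q[T]$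 and that all conjugates of $\lambda$ over $\mathbb{F}_q(T)$ (that is, all elements of $\mathbb{C}_{\mathfrak{P}}$ with the same minimal polynomial over $\mathbb{F}_q(T)$ as $\lambda$) lie in $\mathbb{S}_q$. Then $\lambda\in\mathbb{T}_q$. -/

import Mathlib

open Polynomial

noncomputable section

namespace Carlitz

section Action

variable (Fq : Type*) [Field Fq] [Fintype Fq]
  (L : Type*) [CommRing L] [Algebra Fq L] [Algebra Fq[X] L]

/-- The `Fq`-linear operator `φ_q + μ_T`, that is `u ↦ u ^ q + T u`, on an algebra `L` over
`Fq[T]`, where `q = #Fq`. -/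
def frobAddMulT : Module.End Fq L :=
  (FiniteField.frobeniusAlgHom Fq L).toLinearMap +
    LinearMap.mulLeft Fq (algebraMap Fq[X] L X)

variable {Fq L}

/-- The Carlitz action of `M = ∑ aᵢ Tⁱ` on `u`: it is `∑ aᵢ (φ_q + μ_T)ⁱ(u)`. -/
def carlitz (M : Fq[X]) (u : L) : L :=
  (aeval (frobAddMulT Fq L) M) u

end Action

variable (Fq : Type*) [Field Fq] [Fintype Fq]

/-- A fixed algebraic closure of the rational function field `Fq(T)`. -/
abbrev KBar : Type _ := AlgebraicClosure (RatFunc Fq)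

/-- The set `Λ_M` of `M`-torsion points of the Carlitz action. -/
def torsionBy (M : Fq[X]) : Set (KBar Fq) :=
  {u | carlitz M u = 0}

/-- The set `𝕋_q` of all Carlitz torsion points: the union of the `Λ_M` over nonzero `M`. -/
def torsion : Set (KBar Fq) :=
  ⋃ M ∈ {M : Fq[X] | M ≠ 0}, torsionBy Fq M

open scoped Classical in
/-- A place of the algebraic closure of `Fq(T)` (given by its valuation ring) lies above the
infinite place if its valuation ring contracts to that of the infinite place of `Fq(T)`. -/
def LiesAboveInfinity (P : ValuationSubring (KBar Fq)) : Prop :=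
  P.comap (algebraMap (RatFunc Fq) (KBar Fq)) = (RatFunc.inftyValuation Fq).valuationSubring

variable {Fq}

/-- The completion of the algebraic closure of `Fq(T)` at the place `P`. -/
def CompletionAt (P : ValuationSubring (KBar Fq)) : Type _ :=
  P.valuation.Completion

variable (P : ValuationSubring (KBar Fq))

instance : Field (CompletionAt P) :=
  inferInstanceAs (Field P.valuation.Completion)

instance : Valued (CompletionAt P) P.ValueGroup :=
  inferInstanceAs (Valued P.valuation.Completion P.ValueGroup)

/-- The canonical embedding of the algebraic closure of `Fq(T)` into its completion at `P`. -/
def toCompletion : KBar Fq →+* CompletionAt P :=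
  (UniformSpace.Completion.coeRingHom (α := WithVal P.valuation)).comp
    (WithVal.equiv P.valuation).symm.toRingHom

instance : Algebra (RatFunc Fq) (CompletionAt P) :=
  ((toCompletion P).comp (algebraMap (RatFunc Fq) (KBar Fq))).toAlgebra

instance : Algebra Fq[X] (CompletionAt P) :=
  ((algebraMap (RatFunc Fq) (CompletionAt P)).comp (algebraMap Fq[X] (RatFunc Fq))).toAlgebra

instance : IsScalarTower Fq[X] (RatFunc Fq) (CompletionAt P) :=
  IsScalarTower.of_algebraMap_eq fun _ => rfl

/-- The torsion points `𝕋_q`, viewed in the completion at `P`. -/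
def torsionIn : Set (CompletionAt P) :=
  toCompletion P '' torsion Fq

/-- The `q`-unit circle `𝕊_q` at `P`: the completion of `𝕋_q` at `P`, realised as the closure of
`𝕋_q` in the completion of the algebraic closure of `Fq(T)` at `P`. -/
def unitCircle : Set (CompletionAt P) :=
  closure (torsionIn P)

end Carlitz

end

open Polynomial

namespace Carlitz

/-! This is a Kronecker-type argument for `f u = u ^ q + T u`. Outside the disc `|u| ≤ |T|` the map
`f` strictly increases the valuation, so torsion lies in the disc (`valuation_le_of_mem_torsion`);
the disc is closed, so it contains `𝕊_q` too. Since `f` preserves `𝕊_q` and commutes with Galois,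
every iterate `f^[n] λ` is integral, of degree at most that of `λ`, with all conjugates in the disc.
Only finitely many such elements exist (`finite_setOf_isIntegral_conj_le`), so `f^[m] λ = f^[n] λ`
for some `m ≠ n`, and `X ^ m - X ^ n` kills `λ`. -/

/-- If all elements of a multiset have valuation at most `c ≥ 1`, then the coefficients of
`∏ (X - a)` have valuation at most `c ^ card`. -/
theorem valuation_coeff_prod_X_sub_C_le {K Γ : Type*} [Field K]
    [LinearOrderedCommGroupWithZero Γ] (v : Valuation K Γ) {c : Γ} (hc : 1 ≤ c)
    (s : Multiset K) (hs : ∀ a ∈ s, v a ≤ c) (i : ℕ) :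
    v ((s.map fun a => X - C a).prod.coeff i) ≤ c ^ s.card := by
  induction s using Multiset.induction generalizing i with
  | empty =>
    simp only [Multiset.map_zero, Multiset.prod_zero, coeff_one, Multiset.card_zero, pow_zero]
    split_ifs <;> simp
  | cons a s ih =>
    have ih' := ih fun b hb => hs b (Multiset.mem_cons_of_mem hb)
    rw [Multiset.map_cons, Multiset.prod_cons, sub_mul, coeff_sub, Multiset.card_cons]
    refine v.map_sub_le ?_ ?_
    · cases i with
      | zero => simp
      | succ i =>
        rw [coeff_X_mul]
        exact (ih' i).trans (pow_le_pow_right₀ hc (Nat.le_succ _))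
    · rw [coeff_C_mul, map_mul, pow_succ']
      exact mul_le_mul' (hs a (Multiset.mem_cons_self _ _)) (ih' i)

/-! ### The Carlitz action and its iterates. -/

variable {Fq : Type*} [Field Fq] [Fintype Fq]

theorem frobAddMulT_apply {L : Type*} [CommRing L] [Algebra Fq L] [Algebra Fq[X] L] (u : L) :
    frobAddMulT Fq L u = u ^ Fintype.card Fq + algebraMap Fq[X] L X * u := rfl

theorem carlitz_mul {L : Type*} [CommRing L] [Algebra Fq L] [Algebra Fq[X] L]
    (M N : Fq[X]) (u : L) : carlitz (M * N) u = carlitz M (carlitz N u) := by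
  simp [carlitz]

theorem carlitz_add {L : Type*} [CommRing L] [Algebra Fq L] [Algebra Fq[X] L]
    (M N : Fq[X]) (u : L) : carlitz (M + N) u = carlitz M u + carlitz N u := by
  simp [carlitz]

theorem carlitz_C {L : Type*} [CommRing L] [Algebra Fq L] [Algebra Fq[X] L] (a : Fq) (u : L) :
    carlitz (C a) u = a • u := by
  simp [carlitz]

theorem carlitz_X {L : Type*} [CommRing L] [Algebra Fq L] [Algebra Fq[X] L] (u : L) :
    carlitz (X : Fq[X]) u = frobAddMulT Fq L u := by
  simp [carlitz]

theorem carlitz_X_pow {L : Type*} [CommRing L] [Algebra Fq L] [Algebra Fq[X] L] (n : ℕ) (u : L) :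
    carlitz (X ^ n : Fq[X]) u = (frobAddMulT Fq L)^[n] u := by
  simp [carlitz, Module.End.pow_apply]

theorem mem_torsion {u : KBar Fq} : u ∈ torsion Fq ↔ ∃ M : Fq[X], M ≠ 0 ∧ carlitz M u = 0 := by
  simp [torsion, torsionBy]

theorem frobAddMulT_mem_torsion {u : KBar Fq} (hu : u ∈ torsion Fq) :
    frobAddMulT Fq (KBar Fq) u ∈ torsion Fq := by
  obtain ⟨M, hM, h⟩ := mem_torsion.1 hu
  refine mem_torsion.2 ⟨M, hM, ?_⟩
  rw [← carlitz_X, ← carlitz_mul, mul_comm, carlitz_mul, h]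
  simp [carlitz]

theorem iterate_frobAddMulT_algEquiv (σ : KBar Fq ≃ₐ[RatFunc Fq] KBar Fq) (n : ℕ) (u : KBar Fq) :
    σ ((frobAddMulT Fq (KBar Fq))^[n] u) = (frobAddMulT Fq (KBar Fq))^[n] (σ u) := by
  refine Function.Semiconj.iterate_right (fun x => ?_) n u
  rw [frobAddMulT_apply, frobAddMulT_apply, map_add, map_pow, map_mul,
    IsScalarTower.algebraMap_apply Fq[X] (RatFunc Fq) (KBar Fq), AlgEquiv.commutes]

theorem isIntegral_iterate_frobAddMulT {u : KBar Fq} (hu : IsIntegral Fq[X] u) (n : ℕ) :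
    IsIntegral Fq[X] ((frobAddMulT Fq (KBar Fq))^[n] u) := by
  induction n with
  | zero => exact hu
  | succ n ih =>
    rw [Function.iterate_succ_apply', frobAddMulT_apply]
    exact (ih.pow _).add (isIntegral_algebraMap.mul ih)

theorem iterate_frobAddMulT_mem (F : IntermediateField (RatFunc Fq) (KBar Fq)) {u : KBar Fq}
    (hu : u ∈ F) (n : ℕ) : (frobAddMulT Fq (KBar Fq))^[n] u ∈ F := by
  induction n with
  | zero => exact hu
  | succ n ih =>
    rw [Function.iterate_succ_apply', frobAddMulT_apply,
      IsScalarTower.algebraMap_apply Fq[X] (RatFunc Fq) (KBar Fq)]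
    exact add_mem (pow_mem ih _) (mul_mem (F.algebraMap_mem _) ih)

theorem natDegree_minpoly_iterate_frobAddMulT_le (u : KBar Fq) (n : ℕ) :
    (minpoly (RatFunc Fq) ((frobAddMulT Fq (KBar Fq))^[n] u)).natDegree ≤
      (minpoly (RatFunc Fq) u).natDegree := by
  have hu : IsIntegral (RatFunc Fq) u := Algebra.IsIntegral.isIntegral u
  have : FiniteDimensional (RatFunc Fq) (IntermediateField.adjoin (RatFunc Fq) {u}) :=
    IntermediateField.adjoin.finiteDimensional hu
  rw [← IntermediateField.adjoin.finrank hu]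
  have h := minpoly.natDegree_le (A := RatFunc Fq) (⟨_, iterate_frobAddMulT_mem _
    (IntermediateField.mem_adjoin_simple_self (RatFunc Fq) u) n⟩ :
      IntermediateField.adjoin (RatFunc Fq) {u})
  rwa [IntermediateField.minpoly_eq] at h

theorem mem_torsion_of_iterate_eq {u : KBar Fq} {m n : ℕ} (hmn : m ≠ n)
    (h : (frobAddMulT Fq (KBar Fq))^[m] u = (frobAddMulT Fq (KBar Fq))^[n] u) :
    u ∈ torsion Fq := by
  refine mem_torsion.2 ⟨X ^ m - X ^ n, fun h0 => hmn ?_, ?_⟩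
  · simpa using congrArg natDegree (sub_eq_zero.1 h0)
  · have : carlitz (X ^ m - X ^ n : Fq[X]) u =
        carlitz (X ^ m : Fq[X]) u - carlitz (X ^ n : Fq[X]) u := by simp [carlitz]
    rw [this, carlitz_X_pow, carlitz_X_pow, h, sub_self]

/-! ### Bounds at infinity and finiteness. -/

section Valuation

variable {P : ValuationSubring (KBar Fq)}

omit [Fintype Fq] in
open scoped Classical in
theorem valuation_algebraMap_le_one_iff (hP : LiesAboveInfinity Fq P) (r : RatFunc Fq) :
    P.valuation (algebraMap (RatFunc Fq) (KBar Fq) r) ≤ 1 ↔ RatFunc.inftyValuation Fq r ≤ 1 := by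
  rw [P.valuation_le_one_iff, ← ValuationSubring.mem_comap, hP, Valuation.mem_valuationSubring_iff]

omit [Fintype Fq] in
open scoped Classical in
theorem inftyValuation_algebraMap {p : Fq[X]} (hp : p ≠ 0) :
    RatFunc.inftyValuation Fq (algebraMap Fq[X] (RatFunc Fq) p) =
      WithZero.exp (p.natDegree : ℤ) :=
  RatFunc.inftyValuation.polynomial Fq hp

omit [Fintype Fq] in
theorem one_lt_valuation_X (hP : LiesAboveInfinity Fq P) :
    1 < P.valuation (algebraMap Fq[X] (KBar Fq) X) := by
  classical
  rw [IsScalarTower.algebraMap_apply Fq[X] (RatFunc Fq) (KBar Fq), ← not_le,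
    valuation_algebraMap_le_one_iff hP, inftyValuation_algebraMap X_ne_zero, not_le, natDegree_X]
  exact WithZero.exp_lt_exp.2 Int.one_pos

-- The place is known only through its valuation ring, so the bound is rephrased as integrality of
-- `p / T ^ n`.
omit [Fintype Fq] in
theorem natDegree_le_of_valuation_le (hP : LiesAboveInfinity Fq P) {p : Fq[X]} {n : ℕ}
    (h : P.valuation (algebraMap Fq[X] (KBar Fq) p) ≤
      P.valuation (algebraMap Fq[X] (KBar Fq) X) ^ n) : p.natDegree ≤ n := by
  classical
  rcases eq_or_ne p 0 with rfl | hp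
  · simp
  have hX : P.valuation (algebraMap Fq[X] (KBar Fq) X) ^ n ≠ 0 :=
    pow_ne_zero _ (zero_lt_one.trans (one_lt_valuation_X hP)).ne'
  have h1 : P.valuation (algebraMap (RatFunc Fq) (KBar Fq)
      (algebraMap Fq[X] (RatFunc Fq) p / algebraMap Fq[X] (RatFunc Fq) (X ^ n))) ≤ 1 := by
    rw [map_div₀, ← IsScalarTower.algebraMap_apply, ← IsScalarTower.algebraMap_apply, map_div₀,
      map_pow, map_pow]
    exact div_le_one_of_le₀ h zero_le
  rw [valuation_algebraMap_le_one_iff hP, map_div₀, inftyValuation_algebraMap hp,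
    inftyValuation_algebraMap (pow_ne_zero n X_ne_zero), natDegree_X_pow,
    div_le_one₀ (by simp), WithZero.exp_le_exp] at h1
  exact_mod_cast h1

theorem valuation_smul {a : Fq} (ha : a ≠ 0) (P : ValuationSubring (KBar Fq)) (u : KBar Fq) :
    P.valuation (a • u) = P.valuation u := by
  have h : P.valuation (algebraMap Fq (KBar Fq) a) = 1 := by
    -- A nonzero constant is a root of unity, of order dividing `q - 1`.
    refine (pow_eq_one_iff_of_nonneg zero_le
      (Nat.sub_ne_zero_of_lt (Fintype.one_lt_card (α := Fq)))).1 ?_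
    rw [← map_pow, ← map_pow, FiniteField.pow_card_sub_one_eq_one a ha, map_one, map_one]
  rw [Algebra.smul_def, map_mul, h, one_mul]

theorem valuation_smul_le (a : Fq) (P : ValuationSubring (KBar Fq)) (u : KBar Fq) :
    P.valuation (a • u) ≤ P.valuation u := by
  rcases eq_or_ne a 0 with rfl | ha
  · simp
  · exact (valuation_smul ha P u).le

/-- When `|u| > |T|`, the term `u ^ q` dominates `T u` because `q ≥ 2`. -/
theorem valuation_lt_frobAddMulT (hP : LiesAboveInfinity Fq P) {u : KBar Fq}
    (hu : P.valuation (algebraMap Fq[X] (KBar Fq) X) < P.valuation u) :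
    P.valuation u < P.valuation (frobAddMulT Fq (KBar Fq) u) := by
  have hT := one_lt_valuation_X hP
  have h1 := hT.trans hu
  have h0 := zero_lt_one.trans h1
  have hmul : P.valuation (algebraMap Fq[X] (KBar Fq) X * u) <
      P.valuation (u ^ Fintype.card Fq) := by
    rw [map_mul, map_pow]
    calc _ < P.valuation u * P.valuation u := by gcongr
      _ = P.valuation u ^ 2 := (sq _).symm
      _ ≤ _ := pow_le_pow_right₀ h1.le Fintype.one_lt_card
  rw [frobAddMulT_apply, Valuation.map_add_eq_of_lt_left _ hmul, map_pow]
  exact lt_self_pow₀ h1 Fintype.one_lt_card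

/-- Horner induction on `M = M.divX * X + C a`: applying `f` to the value of `M.divX` enlarges it
strictly, so adding `a • u` cannot cancel it. -/
theorem valuation_le_carlitz (hP : LiesAboveInfinity Fq P) {u : KBar Fq}
    (hu : P.valuation (algebraMap Fq[X] (KBar Fq) X) < P.valuation u) (M : Fq[X]) (hM : M ≠ 0) :
    P.valuation u ≤ P.valuation (carlitz M u) := by
  induction hn : M.natDegree generalizing M with
  | zero =>
    obtain ⟨a, rfl⟩ := natDegree_eq_zero.1 hn
    rw [carlitz_C, valuation_smul (C_ne_zero.1 hM)]
  | succ n ih =>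
    have hdeg : M.divX.natDegree = n := by rw [natDegree_divX_eq_natDegree_tsub_one, hn]; rfl
    have hne : M.divX ≠ 0 := fun h0 => by
      rw [← divX_mul_X_add M, h0, zero_mul, zero_add, natDegree_C] at hn
      omega
    have hle := ih _ hne hdeg
    have hlt := hle.trans_lt (valuation_lt_frobAddMulT hP (hu.trans_le hle))
    rw [← divX_mul_X_add M, carlitz_add, carlitz_C, mul_comm, carlitz_mul, carlitz_X,
      Valuation.map_add_eq_of_lt_left]
    · exact hlt.le
    · exact (valuation_smul_le _ P u).trans_lt hlt

theorem valuation_le_of_mem_torsion (hP : LiesAboveInfinity Fq P) {u : KBar Fq}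
    (hu : u ∈ torsion Fq) : P.valuation u ≤ P.valuation (algebraMap Fq[X] (KBar Fq) X) := by
  obtain ⟨M, hM, h⟩ := mem_torsion.1 hu
  by_contra! hlt
  have := valuation_le_carlitz hP hlt M hM
  rw [h, map_zero] at this
  exact (zero_le.trans_lt hlt).not_ge this

/-- Elements of the algebraic closure integral over `Fq[T]`, of bounded degree and all of whose
conjugates are bounded by `|T|`, form a finite set. -/
theorem finite_setOf_isIntegral_conj_le (hP : LiesAboveInfinity Fq P) (d : ℕ) :
    {x : KBar Fq | IsIntegral Fq[X] x ∧ (minpoly (RatFunc Fq) x).natDegree ≤ d ∧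
      ∀ y, IsConjRoot (RatFunc Fq) x y →
        P.valuation y ≤ P.valuation (algebraMap Fq[X] (KBar Fq) X)}.Finite := by
  classical
  have hU : {p : Fq[X] | p.natDegree ≤ d}.Finite := by
    have : Finite (degreeLT Fq (d + 1)) := Module.finite_of_finite Fq
    refine (Set.toFinite (degreeLT Fq (d + 1) : Set Fq[X])).subset fun p hp => ?_
    exact mem_degreeLT.2 ((degree_le_of_natDegree_le hp).trans_lt (by exact_mod_cast Nat.lt_succ_self d))
  refine (bUnion_roots_finite (algebraMap Fq[X] (KBar Fq)) d hU).subset ?_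
  rintro x ⟨hx, hd, hconj⟩
  -- By integral closedness the minimal polynomial has coefficients in `Fq[T]`, whose sizes at
  -- infinity are degrees.
  have hmin := minpoly.isIntegrallyClosed_eq_field_fractions' (RatFunc Fq) hx
  have hmap : (minpoly Fq[X] x).map (algebraMap Fq[X] (KBar Fq)) =
      (minpoly (RatFunc Fq) x).map (algebraMap (RatFunc Fq) (KBar Fq)) := by
    rw [hmin, Polynomial.map_map, ← IsScalarTower.algebraMap_eq]
  have hdeg : (minpoly Fq[X] x).natDegree ≤ d := by
    rwa [hmin, (minpoly.monic hx).natDegree_map] at hd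
  have hmonic := (minpoly.monic hx).map (algebraMap Fq[X] (KBar Fq))
  simp only [Set.mem_iUnion]
  refine ⟨minpoly Fq[X] x, ⟨hdeg, fun i => ?_⟩, ?_⟩
  -- Coefficients are symmetric functions of at most `d` conjugates, hence bounded by `|T| ^ d`.
  · refine natDegree_le_of_valuation_le hP ?_
    have hsplit := IsAlgClosed.splits ((minpoly Fq[X] x).map (algebraMap Fq[X] (KBar Fq)))
    rw [← coeff_map, hsplit.eq_prod_roots_of_monic hmonic]
    refine (valuation_coeff_prod_X_sub_C_le P.valuation (one_lt_valuation_X hP).le _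
      (fun a ha => hconj a ?_) i).trans (pow_le_pow_right₀ (one_lt_valuation_X hP).le ?_)
    · refine (isConjRoot_iff_mem_minpoly_aroots hx.tower_top).2 ?_
      rwa [aroots, ← hmap]
    · exact (card_roots' _).trans (natDegree_map_le.trans hdeg)
  · rw [Finset.mem_coe, Multiset.mem_toFinset, mem_roots hmonic.ne_zero, IsRoot, eval_map_algebraMap]
    exact minpoly.aeval _ _

end Valuation

/-! ### Passage to the completion. -/

section Completion

variable (P : ValuationSubring (KBar Fq))

omit [Fintype Fq] in
theorem valued_toCompletion (x : KBar Fq) :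
    Valued.v (toCompletion P x) = P.valuation x :=
  Valued.valuedCompletion_apply (K := WithVal P.valuation) _

/-- The embedding of the algebraic closure in its completion, over `Fq(T)`. -/
noncomputable def toCompletionAlgHom : KBar Fq →ₐ[RatFunc Fq] CompletionAt P :=
  { toCompletion P with commutes' := fun _ => rfl }

omit [Fintype Fq] in
theorem mem_range_toCompletion {y : CompletionAt P} (hy : IsIntegral (RatFunc Fq) y) :
    ∃ x, toCompletion P x = y := by
  have hne := (minpoly.monic hy).map (algebraMap (RatFunc Fq) (KBar Fq)) |>.ne_zero
  refine (IsAlgClosed.splits _).mem_range_of_isRoot hne (i := toCompletion P) ?_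
  rw [Polynomial.map_map, IsRoot, ← eval₂_eq_eval_map]
  exact minpoly.aeval (RatFunc Fq) y

theorem toCompletion_frobAddMulT_mem_unitCircle {u : KBar Fq} (hu : toCompletion P u ∈ unitCircle P) :
    toCompletion P (frobAddMulT Fq (KBar Fq) u) ∈ unitCircle P := by
  have hcont : Continuous fun y : CompletionAt P =>
      y ^ Fintype.card Fq + toCompletion P (algebraMap Fq[X] (KBar Fq) X) * y := by fun_prop
  rw [frobAddMulT_apply, map_add, map_pow, map_mul]
  refine map_mem_closure (f := fun y => y ^ Fintype.card Fq +
    toCompletion P (algebraMap Fq[X] (KBar Fq) X) * y) hcont hu ?_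
  rintro _ ⟨t, ht, rfl⟩
  exact ⟨_, frobAddMulT_mem_torsion ht, by rw [frobAddMulT_apply, map_add, map_pow, map_mul]⟩

variable {P}

theorem valuation_le_of_mem_unitCircle (hP : LiesAboveInfinity Fq P) {u : KBar Fq}
    (hu : toCompletion P u ∈ unitCircle P) :
    P.valuation u ≤ P.valuation (algebraMap Fq[X] (KBar Fq) X) := by
  have hclosed := Valued.isClosed_closedBall (CompletionAt P)
    (Valued.v.restrict (toCompletion P (algebraMap Fq[X] (KBar Fq) X)))
  have h := closure_minimal (s := torsionIn P) ?_ hclosed hu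
  · simpa [valued_toCompletion] using h
  · rintro _ ⟨t, ht, rfl⟩
    simpa [valued_toCompletion] using valuation_le_of_mem_torsion hP ht

end Completion

end Carlitz

theorem mainTheorem3 {Fq : Type*} [Field Fq] [Fintype Fq]
    (P : ValuationSubring (Carlitz.KBar Fq)) (hP : Carlitz.LiesAboveInfinity Fq P)
    (lam : Carlitz.CompletionAt P)
    (hmem : lam ∈ Carlitz.unitCircle P)
    (hint : IsIntegral (Polynomial Fq) lam)
    (hconj : ∀ μ : Carlitz.CompletionAt P,
      IsConjRoot (RatFunc Fq) lam μ → μ ∈ Carlitz.unitCircle P) :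
    lam ∈ Carlitz.torsionIn P := by
  obtain ⟨l, rfl⟩ := Carlitz.mem_range_toCompletion P (hint.tower_top (A := RatFunc Fq))
  let f := Carlitz.frobAddMulT Fq (Carlitz.KBar Fq)
  have hlint : IsIntegral (Polynomial Fq) l := by
    refine (isIntegral_algHom_iff
      ((Carlitz.toCompletionAlgHom P).restrictScalars (Polynomial Fq))
      (Carlitz.toCompletionAlgHom P).injective).1 hint
  have hconj' : ∀ m, IsConjRoot (RatFunc Fq) l m →
      Carlitz.toCompletion P m ∈ Carlitz.unitCircle P := fun m hm =>
    hconj _ ((isConjRoot_algHom_iff (Carlitz.toCompletionAlgHom P)).2 hm)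
  have hiter : ∀ n (m : Carlitz.KBar Fq), Carlitz.toCompletion P m ∈ Carlitz.unitCircle P →
      Carlitz.toCompletion P (f^[n] m) ∈ Carlitz.unitCircle P := by
    intro n
    induction n with
    | zero => exact fun m hm => hm
    | succ n ih =>
      exact fun m hm => ih _ (Carlitz.toCompletion_frobAddMulT_mem_unitCircle P hm)
  have hfin := Carlitz.finite_setOf_isIntegral_conj_le hP (minpoly (RatFunc Fq) l).natDegree
  have hmaps : ∀ n, f^[n] l ∈ {x : Carlitz.KBar Fq | IsIntegral (Polynomial Fq) x ∧
      (minpoly (RatFunc Fq) x).natDegree ≤ (minpoly (RatFunc Fq) l).natDegree ∧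
      ∀ y, IsConjRoot (RatFunc Fq) x y → P.valuation y ≤
        P.valuation (algebraMap (Polynomial Fq) (Carlitz.KBar Fq) Polynomial.X)} := by
    refine fun n => ⟨Carlitz.isIntegral_iterate_frobAddMulT hlint n,
      Carlitz.natDegree_minpoly_iterate_frobAddMulT_le l n, fun y hy => ?_⟩
    -- A conjugate of `f^[n] l` is `σ (f^[n] l) = f^[n] (σ l)`, an iterate of a conjugate of `l`, so
    -- it stays in `𝕊_q`.
    obtain ⟨σ, rfl⟩ := hy.symm.exists_algEquiv
    refine Carlitz.valuation_le_of_mem_unitCircle hP ?_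
    simp only [Carlitz.iterate_frobAddMulT_algEquiv, f]
    exact hiter n _ (hconj' _ (isConjRoot_of_algEquiv l σ))
  obtain ⟨m, -, n, -, hmn, h⟩ := Set.infinite_univ.exists_ne_map_eq_of_mapsTo
    (fun n _ => hmaps n) hfin
  exact ⟨l, Carlitz.mem_torsion_of_iterate_eq hmn h, rfl⟩
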